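/- Let $\Delta=\sigma_1\cup\dots\cup\sigma_k\subset\mathbb{R}^n$ be a (finite) simplicial complex with vertices $v_1,\dots,v_m$, and let $C^0(\Delta)$ be the $\mathbb{R}$-algebra of all continuous functions $F\colon\Delta\to\mathbb{R}$ whose restriction to each simplex of $\Delta$ is given by a polynomial in $n$ variables. For $i=1,\dots,m$ let $T_i\in C^0(\Delta)$ be the tent function at $v_i$, i.e. the unique function that is affine-linear on each simplex of $\Delta$ and satisfies $T_i(v_i)=1$ and $T_i(v_j)=0$ for $j\neq i$. If $F\in C^0(\Delta)$ is strictly positive on $\Delta$, then there exist sums of squares $S_0,S_1,\dots,S_m$ of elements of $C^0(\Delta)$ such that $$F=S_0+\sum_{i=1}^m S_iT_i.$$ -/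

import Mathlib

noncomputable section

namespace SimplicialSpline

/-- The real algebra `C⁰(Δ)` of all continuous functions on (the underlying space of) a simplicial
complex in `ℝⁿ` whose restriction to each simplex is given by a polynomial in `n` variables. -/
def C0 {n : ℕ} (K : Geometry.SimplicialComplex ℝ (EuclideanSpace ℝ (Fin n))) :
    Subalgebra ℝ C(K.space, ℝ) where
  carrier := {f | ∀ s ∈ K.faces, ∃ p : MvPolynomial (Fin n) ℝ, ∀ x : K.space,
    (x : EuclideanSpace ℝ (Fin n)) ∈ convexHull ℝ (s : Set (EuclideanSpace ℝ (Fin n))) →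
      f x = MvPolynomial.eval (fun i => (x : EuclideanSpace ℝ (Fin n)) i) p}
  mul_mem' := by
    intro f g hf hg s hs
    obtain ⟨p, hp⟩ := hf s hs
    obtain ⟨q, hq⟩ := hg s hs
    exact ⟨p * q, fun x hx => by simp [hp x hx, hq x hx]⟩
  add_mem' := by
    intro f g hf hg s hs
    obtain ⟨p, hp⟩ := hf s hs
    obtain ⟨q, hq⟩ := hg s hs
    exact ⟨p + q, fun x hx => by simp [hp x hx, hq x hx]⟩
  algebraMap_mem' := fun r _ _ => ⟨MvPolynomial.C r, fun x _ => by simp⟩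

/-- `T ∈ C⁰(Δ)` is a tent function (Courant function) at the vertex `v`: it is piecewise linear,
i.e. given by an affine-linear function on each simplex, it takes the value `1` at `v`, and it
vanishes at all other vertices. -/
structure IsTentFunction {n : ℕ} (K : Geometry.SimplicialComplex ℝ (EuclideanSpace ℝ (Fin n)))
    (v : K.vertices) (T : C0 K) : Prop where
  piecewise_linear : ∀ s ∈ K.faces, ∃ g : EuclideanSpace ℝ (Fin n) →ᵃ[ℝ] ℝ, ∀ x : K.space,
    (x : EuclideanSpace ℝ (Fin n)) ∈ convexHull ℝ (s : Set (EuclideanSpace ℝ (Fin n))) →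
      (T : C(K.space, ℝ)) x = g x
  apply_self : (T : C(K.space, ℝ)) ⟨v, K.vertices_subset_space v.2⟩ = 1
  apply_of_ne : ∀ w : K.vertices, w ≠ v →
    (T : C(K.space, ℝ)) ⟨w, K.vertices_subset_space w.2⟩ = 0

lemma affine_eq_on_convexHull {E : Type*} [AddCommGroup E] [Module ℝ E] (g h : E →ᵃ[ℝ] ℝ)
    {s : Set E} (hs : ∀ w ∈ s, g w = h w) {x : E} (hx : x ∈ convexHull ℝ s) : g x = h x := by
  have hc : Convex ℝ ((g - h) ⁻¹' {0}) := (convex_singleton (0 : ℝ)).affine_preimage (g - h)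
  have := convexHull_min (s := s) (fun w hw => by simp [hs w hw]) hc hx
  simpa [sub_eq_zero] using this

lemma exists_affine_of_indep {E : Type*} [AddCommGroup E] [Module ℝ E] (s : Set E)
    (hs : AffineIndependent ℝ ((↑) : s → E)) (v : E) :
    ∃ g : E →ᵃ[ℝ] ℝ, (v ∈ s → g v = 1) ∧ ∀ w ∈ s, w ≠ v → g w = 0 := by
  by_cases hv : v ∈ s
  · obtain ⟨t, hst, ht, htop⟩ := exists_subset_affineIndependent_affineSpan_eq_top hs
    let b : AffineBasis t ℝ E := ⟨(↑), ht, by simpa using htop⟩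
    refine ⟨b.coord ⟨v, hst hv⟩, fun _ => b.coord_apply_eq ⟨v, hst hv⟩, fun w hw hne => ?_⟩
    refine b.coord_apply_ne (i := ⟨v, hst hv⟩) (j := ⟨w, hst hw⟩) ?_
    intro h
    exact hne (congrArg Subtype.val h).symm
  · exact ⟨0, fun h => absurd h hv, fun _ _ _ => rfl⟩

lemma exists_polynomial_of_affine {n : ℕ} (g : EuclideanSpace ℝ (Fin n) →ᵃ[ℝ] ℝ) :
    ∃ p : MvPolynomial (Fin n) ℝ, ∀ x, g x = MvPolynomial.eval (fun i => x i) p := by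
  let b := (EuclideanSpace.basisFun (Fin n) ℝ).toBasis
  refine ⟨MvPolynomial.C (g 0) + ∑ i, MvPolynomial.C (g.linear (b i)) * MvPolynomial.X i,
    fun x => ?_⟩
  have h1 : g x = g.linear x + g 0 := congrFun g.decomp x
  have h2 : g.linear x = ∑ i, x i * g.linear (b i) := by
    conv_lhs => rw [← b.sum_repr x]
    simp [b]
  rw [h1, h2]
  simp [add_comm, mul_comm]

/-- Existence of tent functions. -/
theorem exists_isTentFunction {n : ℕ}
    (K : Geometry.SimplicialComplex ℝ (EuclideanSpace ℝ (Fin n))) (hK : K.faces.Finite)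
    (v : K.vertices) : ∃ T : C0 K, IsTentFunction K v T := by
  choose! g hg1 hg0 using fun (s : Finset (EuclideanSpace ℝ (Fin n))) (hs : s ∈ K.faces) =>
    exists_affine_of_indep (s : Set _) (K.indep hs) (v : EuclideanSpace ℝ (Fin n))
  choose c hc hxc using fun x : K.space => Geometry.SimplicialComplex.mem_space_iff.1 x.2
  have key : ∀ s ∈ K.faces, ∀ x : K.space,
      (x : EuclideanSpace ℝ (Fin n)) ∈ convexHull ℝ (s : Set (EuclideanSpace ℝ (Fin n))) →
      g (c x) x = g s x := by
    intro s hs x hx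
    refine affine_eq_on_convexHull _ _ ?_ (K.inter_subset_convexHull (hc x) hs ⟨hxc x, hx⟩)
    rintro w ⟨hw1, hw2⟩
    by_cases hwv : w = v
    · subst hwv
      rw [hg1 _ (hc x) hw1, hg1 s hs hw2]
    · rw [hg0 _ (hc x) w hw1 hwv, hg0 s hs w hw2 hwv]
  have hcont : Continuous fun x : K.space => g (c x) x := by
    have : Finite K.faces := hK
    refine (locallyFinite_of_finite fun s : K.faces =>
      {x : K.space | (x : EuclideanSpace ℝ (Fin n)) ∈
        convexHull ℝ (s.1 : Set (EuclideanSpace ℝ (Fin n)))}).continuous ?_ ?_ ?_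
    · exact Set.eq_univ_of_forall fun x => Set.mem_iUnion.2 ⟨⟨c x, hc x⟩, hxc x⟩
    · intro s
      exact (s.1.finite_toSet.isClosed_convexHull (𝕜 := ℝ)).preimage
        continuous_subtype_val
    · intro s
      refine ContinuousOn.congr (f := fun x : K.space => g s x) ?_ (fun x hx => key s s.2 x hx)
      exact ((g s).continuous_of_finiteDimensional.comp continuous_subtype_val).continuousOn
  refine ⟨⟨⟨fun x => g (c x) x, hcont⟩, ?_⟩, ?_, ?_, ?_⟩
  · intro s hs
    obtain ⟨p, hp⟩ := exists_polynomial_of_affine (g s)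
    exact ⟨p, fun x hx => (key s hs x hx).trans (hp x)⟩
  · exact fun s hs => ⟨g s, fun x hx => key s hs x hx⟩
  · refine (key _ v.2 _ (subset_convexHull ℝ _ (by simp))).trans (hg1 _ v.2 (by simp))
  · intro w hw
    refine (key _ w.2 _ (subset_convexHull ℝ _ (by simp))).trans (hg0 _ w.2 _ (by simp) ?_)
    exact fun h => hw (Subtype.ext h)

/-- Uniqueness of tent functions. -/
theorem IsTentFunction.unique {n : ℕ}
    {K : Geometry.SimplicialComplex ℝ (EuclideanSpace ℝ (Fin n))}
    {v : K.vertices} {T T' : C0 K} (hT : IsTentFunction K v T) (hT' : IsTentFunction K v T') :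
    T = T' := by
  refine Subtype.ext (ContinuousMap.ext fun x => ?_)
  obtain ⟨s, hs, hx⟩ := Geometry.SimplicialComplex.mem_space_iff.1 x.2
  obtain ⟨g, hg⟩ := hT.piecewise_linear s hs
  obtain ⟨g', hg'⟩ := hT'.piecewise_linear s hs
  rw [hg x hx, hg' x hx]
  refine affine_eq_on_convexHull _ _ (fun w hw => ?_) hx
  have hwv : w ∈ K.vertices :=
    K.down_closed hs (Finset.singleton_subset_iff.2 hw) (Finset.singleton_nonempty _)
  have hwc := subset_convexHull ℝ (s : Set (EuclideanSpace ℝ (Fin n))) hw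
  have e1 := hg ⟨w, K.vertices_subset_space hwv⟩ hwc
  have e2 := hg' ⟨w, K.vertices_subset_space hwv⟩ hwc
  rw [← e1, ← e2]
  by_cases h : (⟨w, hwv⟩ : K.vertices) = v
  · subst h
    exact hT.apply_self.trans hT'.apply_self.symm
  · exact (hT.apply_of_ne _ h).trans (hT'.apply_of_ne _ h).symm

/-- The tent function of a finite simplicial complex at the vertex `v`: the unique piecewise
linear function that is `1` at `v` and `0` at all other vertices. -/
def tentFunction {n : ℕ} (K : Geometry.SimplicialComplex ℝ (EuclideanSpace ℝ (Fin n)))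
    (hK : K.faces.Finite) (v : K.vertices) : C0 K :=
  (exists_isTentFunction K hK v).choose

theorem isTentFunction_tentFunction {n : ℕ}
    (K : Geometry.SimplicialComplex ℝ (EuclideanSpace ℝ (Fin n))) (hK : K.faces.Finite)
    (v : K.vertices) : IsTentFunction K v (tentFunction K hK v) :=
  (exists_isTentFunction K hK v).choose_spec

end SimplicialSpline

end

/-! Let `M` be the quadratic module generated by the tent functions `T i` in the algebra of splines;
the theorem says that strictly positive splines lie in `M`. Since the `T i` sum to `1`, both `T i`
and `1 - T i` lie in `M`, so `M` is archimedean. The proof avoids the representation theorem for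
archimedean quadratic modules, and has two ingredients.

The first is algebraic. If `a` and `1 - a` lie in `M`, then repeated use of
`1 - d = (1 - d)² / 2 + (1 - d²) / 2` shows that `a = 1 - (1 - a)` is a sum of squares up to an
arbitrarily small error (`exists_isSumSq_one_sub`). Hence multiplication by `a` preserves membership
in `M` up to small constants (`mul_mem_seqClosure`), and so every monomial in the tent functions lies
in `M` up to small constants (`prod_pow_mem_seqClosure`), although `M` is not assumed to be closed
under products.

The second is Pólya's argument, carried out on the complex. Every spline `F` is a homogeneous
polynomial `P` in the tent functions (`exists_isHomogeneous_aeval_tent_eq`). Multiplying `P` by a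
high power of `∑ T i = 1` makes its coefficient at `α` have the sign of `P (α / D)`, up to an error
that tends to zero (`exists_aeval_eq_sum_nonneg`). If the support of `α` is a face, then `P (α / D)`
is a value of `F`, hence positive; otherwise the monomial vanishes in the algebra of splines
(`prod_tent_pow_eq_zero`).

Together these put positive splines in `M` up to small constants; applied to `F - δ`, with `δ` a
positive constant smaller than `F`, they give `F ∈ M`. -/

noncomputable section

namespace SimplicialSpline

/-! ### Archimedean quadratic modules -/

section QuadraticModule

variable {A : Type*} [CommRing A] {M : Submodule (Subsemiring.sumSq A) A}

lemma sumSq_mul_mem {s x : A} (hs : IsSumSq s) (hx : x ∈ M) : s * x ∈ M :=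
  M.smul_mem ⟨s, Subsemiring.mem_sumSq.2 hs⟩ hx

variable (M) in
/-- `-1 ≤ a ≤ 1` in the preorder on `A` with positive cone `M`. A quadratic module `M` is encoded as
a submodule of `A` over its semiring of sums of squares, with the condition `1 ∈ M` as a separate
hypothesis. -/
def UnitBounded (a : A) : Prop := 1 - a ∈ M ∧ 1 + a ∈ M

lemma UnitBounded.neg {a : A} (ha : UnitBounded M a) : UnitBounded M (-a) :=
  ⟨by simpa using ha.2, by simpa [sub_eq_add_neg] using ha.1⟩

lemma UnitBounded.one (h1 : (1 : A) ∈ M) : UnitBounded M (1 : A) :=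
  ⟨by simp, M.add_mem h1 h1⟩

variable [Algebra ℝ A]

lemma isSumSq_smul {r : ℝ} (hr : 0 ≤ r) {s : A} (hs : IsSumSq s) : IsSumSq (r • s) := by
  have h : r • s = algebraMap ℝ A √r * algebraMap ℝ A √r * s := by
    rw [← map_mul, Real.mul_self_sqrt hr, Algebra.smul_def]
  rw [h]
  exact (IsSumSq.mul_self _).mul hs

lemma nonneg_smul_mem {r : ℝ} (hr : 0 ≤ r) {x : A} (hx : x ∈ M) : r • x ∈ M := by
  have h := sumSq_mul_mem (isSumSq_smul hr (IsSumSq.mul_self (1 : A))) hx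
  simpa using h

lemma UnitBounded.one_sub_sq_mem {a : A} (ha : UnitBounded M a) : 1 - a * a ∈ M := by
  have h := nonneg_smul_mem (r := 1 / 2) (by norm_num)
    (M.add_mem (sumSq_mul_mem (IsSumSq.mul_self (1 + a)) ha.1)
      (sumSq_mul_mem (IsSumSq.mul_self (1 - a)) ha.2))
  convert h using 1
  have e : (1 + a) * (1 + a) * (1 - a) + (1 - a) * (1 - a) * (1 + a)
    = (2 : ℝ) • (1 - a * a) := by
    rw [ofNat_smul_eq_nsmul ℝ 2]; simp only [nsmul_eq_mul]; push_cast; ring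
  rw [e, smul_smul]; norm_num

lemma UnitBounded.half_add {a b : A} (ha : UnitBounded M a) (hb : UnitBounded M b) :
    UnitBounded M ((1 / 2 : ℝ) • (a + b)) := by
  have key : ∀ {a b : A}, 1 - a ∈ M → 1 - b ∈ M → 1 - (1 / 2 : ℝ) • (a + b) ∈ M := by
    intro a b ha hb
    convert nonneg_smul_mem (r := 1 / 2) (by norm_num) (M.add_mem ha hb) using 1
    module
  refine ⟨key ha.1 hb.1, ?_⟩
  convert key ha.neg.1 hb.neg.1 using 1
  module

/-- The product is controlled by polarization: `1 + a b = (1 - ((a - b) / 2)²) + ((a + b) / 2)²`. -/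
lemma UnitBounded.mul (h1 : (1 : A) ∈ M) {a b : A} (ha : UnitBounded M a) (hb : UnitBounded M b) :
    UnitBounded M (a * b) := by
  have key : ∀ {a b : A}, UnitBounded M a → UnitBounded M b → 1 + a * b ∈ M := by
    intro a b ha hb
    have h := M.add_mem (ha.half_add hb.neg).one_sub_sq_mem
      (sumSq_mul_mem (IsSumSq.mul_self ((1 / 2 : ℝ) • (a + b))) h1)
    convert h using 1
    simp only [smul_mul_smul_comm, mul_one]
    have : a * b = (1 / 4 : ℝ) • ((4 : ℝ) • (a * b)) := by rw [smul_smul]; norm_num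
    rw [this, ofNat_smul_eq_nsmul ℝ 4, sub_add, ← smul_sub, sub_eq_add_neg, ← smul_neg]
    norm_num
    ring
  exact ⟨by simpa [sub_eq_add_neg] using key ha.neg hb, key ha hb⟩

lemma UnitBounded.pow (h1 : (1 : A) ∈ M) {a : A} (ha : UnitBounded M a) (k : ℕ) :
    UnitBounded M (a ^ k) := by
  induction k with
  | zero => simpa using UnitBounded.one h1
  | succ k ih => simpa [pow_succ] using ih.mul h1 ha

variable (M) in
/-- The elements that lie in `M` after adding an arbitrarily small positive constant. -/
def seqClosure : Set A := {x | ∀ ε : ℝ, 0 < ε → x + algebraMap ℝ A ε ∈ M}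

lemma algebraMap_mem (h1 : (1 : A) ∈ M) {r : ℝ} (hr : 0 ≤ r) : algebraMap ℝ A r ∈ M := by
  rw [Algebra.algebraMap_eq_smul_one]; exact nonneg_smul_mem hr h1

/-- Iterating `1 - d = (1 - d)² / 2 + (1 - d²) / 2` along `d = c, c², c⁴, …` writes `1 - c` as a sum
of squares up to an error that tends to `0` whenever the powers of `c` stay bounded. -/
lemma exists_isSumSq_one_sub (c : A) (j : ℕ) :
    ∃ s : A, IsSumSq s ∧ 1 - c = s + (1 / 2 : ℝ) ^ j • (1 - c ^ 2 ^ j) := by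
  induction j with
  | zero => exact ⟨0, IsSumSq.zero, by simp⟩
  | succ j ih =>
    obtain ⟨s, hs, h⟩ := ih
    refine ⟨s + (1 / 2 : ℝ) ^ (j + 1) • ((1 - c ^ 2 ^ j) * (1 - c ^ 2 ^ j)),
      hs.add (isSumSq_smul (by positivity) (IsSumSq.mul_self _)), ?_⟩
    rw [h, pow_succ 2 j, pow_mul, add_assoc, ← smul_add]
    congr 1
    have : (1 - c ^ 2 ^ j) * (1 - c ^ 2 ^ j) + (1 - (c ^ 2 ^ j) ^ 2)
        = (2 : ℝ) • (1 - c ^ 2 ^ j) := by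
      rw [ofNat_smul_eq_nsmul ℝ 2]; simp only [nsmul_eq_mul]; push_cast; ring
    rw [this, smul_smul, pow_succ, mul_assoc]
    norm_num

/-- Multiplication by an element of `M`, rather than by a square, is possible up to arbitrarily small
constants: `a = 1 - (1 - a)` is nearly a sum of squares. -/
lemma mul_mem_seqClosure (h1 : (1 : A) ∈ M) {a x : A} (ha : a ∈ M) (ha' : 1 - a ∈ M)
    (hx : x ∈ seqClosure M) (hxb : UnitBounded M x) : a * x ∈ seqClosure M := by
  intro ε hε
  have hc : UnitBounded M (1 - a) := ⟨by simpa using ha, M.add_mem h1 ha'⟩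
  -- `a x + ε = s (x + ε/2) + (ε/2) (1 - s) + q ((1 + x) + (1 - d x)) + (ε/2 - 2q)`, where
  -- `a = s + q (1 - d)`.
  obtain ⟨j, hj⟩ := exists_pow_lt_of_lt_one (show 0 < ε / 4 by positivity)
    (show (1 / 2 : ℝ) < 1 by norm_num)
  obtain ⟨s, hs, h⟩ := exists_isSumSq_one_sub (1 - a) j
  have hk := hc.pow h1 (2 ^ j)
  set d := (1 - a) ^ 2 ^ j
  set q : ℝ := (1 / 2) ^ j
  have hq : 0 ≤ q := by positivity
  have m1 := sumSq_mul_mem hs (hx (ε / 2) (by positivity))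
  have m2 : 1 - s ∈ M := by
    convert M.add_mem ha' (nonneg_smul_mem hq hk.1) using 1
    linear_combination h
  have m3 := nonneg_smul_mem (r := ε / 2) (by positivity) m2
  have m4 := nonneg_smul_mem hq (M.add_mem hxb.2 (hk.mul h1 hxb).1)
  have m5 := algebraMap_mem (M := M) h1 (show 0 ≤ ε / 2 - 2 * q by linarith)
  convert M.add_mem (M.add_mem m1 m3) (M.add_mem m4 m5) using 1
  simp only [Algebra.smul_def] at h ⊢
  have e1 : algebraMap ℝ A ε = algebraMap ℝ A (ε / 2) + algebraMap ℝ A (ε / 2) := by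
    rw [← map_add]; congr 1; ring
  simp only [map_sub, map_mul, map_ofNat]
  linear_combination e1 + x * h

lemma zero_mem_seqClosure (h1 : (1 : A) ∈ M) : (0 : A) ∈ seqClosure M := fun ε hε => by
  simpa using algebraMap_mem h1 hε.le

lemma add_mem_seqClosure {x y : A} (hx : x ∈ seqClosure M)
    (hy : y ∈ seqClosure M) : x + y ∈ seqClosure M := fun ε hε => by
  convert M.add_mem (hx (ε / 2) (by positivity)) (hy (ε / 2) (by positivity)) using 1
  rw [add_add_add_comm, ← map_add, add_halves]

lemma smul_mem_seqClosure (h1 : (1 : A) ∈ M) {r : ℝ} (hr : 0 ≤ r) {x : A}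
    (hx : x ∈ seqClosure M) : r • x ∈ seqClosure M := by
  rcases hr.eq_or_lt with rfl | hr
  · simpa using zero_mem_seqClosure h1
  · intro ε hε
    convert nonneg_smul_mem hr.le (hx (ε / r) (by positivity)) using 1
    rw [smul_add, Algebra.algebraMap_eq_smul_one, Algebra.algebraMap_eq_smul_one, smul_smul,
      mul_div_cancel₀ _ hr.ne']

lemma sum_mem_seqClosure (h1 : (1 : A) ∈ M) {ι : Type*} (t : Finset ι) {f : ι → A}
    (hf : ∀ i ∈ t, f i ∈ seqClosure M) : ∑ i ∈ t, f i ∈ seqClosure M := by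
  induction t using Finset.cons_induction with
  | empty => simpa using zero_mem_seqClosure h1
  | cons i t hi ih =>
    rw [Finset.sum_cons]
    exact add_mem_seqClosure (hf i (by simp)) (ih fun k hk => hf k (by simp [hk]))

lemma prod_pow_mem_seqClosure (h1 : (1 : A) ∈ M) {ι : Type*} {T : ι → A} (hT : ∀ i, T i ∈ M)
    (hT' : ∀ i, 1 - T i ∈ M) (t : Finset ι) (α : ι → ℕ) :
    ∏ i ∈ t, T i ^ α i ∈ seqClosure M ∧ UnitBounded M (∏ i ∈ t, T i ^ α i) := by
  have hTb : ∀ i, UnitBounded M (T i) := fun i => ⟨hT' i, M.add_mem h1 (hT i)⟩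
  induction t using Finset.cons_induction with
  | empty => simpa using ⟨fun ε hε => M.add_mem h1 (algebraMap_mem h1 hε.le), UnitBounded.one h1⟩
  | cons i t hi ih =>
    rw [Finset.prod_cons]
    induction α i with
    | zero => simpa using ih
    | succ k ihk =>
      rw [pow_succ', mul_assoc]
      exact ⟨mul_mem_seqClosure h1 (hT i) (hT' i) ihk.1 ihk.2, (hTb i).mul h1 ihk.2⟩

end QuadraticModule

/-! ### Pólya's theorem -/

section Polya

variable {ι : Type*} [Fintype ι]

/-- The expansion of a monomial of degree `∑ β` in degree `N + ∑ β`, obtained by multiplying it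
by `(∑ T) ^ N = 1`. -/
lemma prod_pow_eq_sum_piAntidiag [DecidableEq ι] {A : Type*} [CommRing A] [Algebra ℝ A]
    {T : ι → A} (hT : ∑ i, T i = 1)
    (β : ι → ℕ) (N : ℕ) :
    ∏ i, T i ^ β i = ∑ α ∈ Finset.piAntidiag Finset.univ (N + ∑ i, β i),
      ((N.factorial : ℝ) / (∏ i, ((α i).factorial : ℝ)) *
        ∏ i, ((α i).descFactorial (β i) : ℝ)) •
        ∏ i, T i ^ α i := by
  have h : ∏ i, T i ^ β i = ∑ γ ∈ Finset.piAntidiag Finset.univ N,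
      ((N.factorial : ℝ) / ∏ i, ((γ i).factorial : ℝ)) • ∏ i, T i ^ (γ i + β i) := by
    calc ∏ i, T i ^ β i = (∑ i, T i) ^ N * ∏ i, T i ^ β i := by rw [hT, one_pow, one_mul]
      _ = _ := by
        rw [Finset.sum_pow_eq_sum_piAntidiag, Finset.sum_mul]
        refine Finset.sum_congr rfl fun γ hγ => ?_
        have hm := Nat.multinomial_spec Finset.univ γ
        rw [(Finset.mem_piAntidiag.1 hγ).1] at hm
        have e : (N.factorial : ℝ) / ∏ i, ((γ i).factorial : ℝ)
            = (Nat.multinomial Finset.univ γ : ℝ) := by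
          rw [← hm]
          push_cast
          exact mul_div_cancel_left₀ _
            (Finset.prod_ne_zero_iff.2 fun i _ => by exact_mod_cast (γ i).factorial_ne_zero)
        rw [e, Nat.cast_smul_eq_nsmul, nsmul_eq_mul]
        simp only [pow_add, Finset.prod_mul_distrib]
        ring
  rw [h]
  refine Finset.sum_of_injOn (fun γ => γ + β) (fun _ _ _ _ h => add_right_cancel h) ?_ ?_ ?_
  · intro γ hγ
    have := (Finset.mem_piAntidiag.1 hγ).1
    simp [Finset.sum_add_distrib, this]
  · intro α hα hα'
    have : ∃ i, α i < β i := by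
      by_contra! hle
      refine hα' ⟨α - β, ?_, funext fun i => Nat.sub_add_cancel (hle i)⟩
      have h1 := (Finset.mem_piAntidiag.1 hα).1
      have h2 : ∑ i, α i = ∑ i, (α - β) i + ∑ i, β i := by
        rw [← Finset.sum_add_distrib]
        exact Finset.sum_congr rfl fun i _ => (Nat.sub_add_cancel (hle i)).symm
      rw [h1] at h2
      simpa using (Nat.add_right_cancel h2).symm
    obtain ⟨i, hi⟩ := this
    have h0 : ∏ i, ((α i).descFactorial (β i) : ℝ) = 0 :=
      Finset.prod_eq_zero (Finset.mem_univ i) (by simpa using hi)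
    rw [h0, mul_zero, zero_smul]
  · intro γ _
    congr 1
    have : ∀ i, ((γ i + β i).factorial : ℝ) =
        (γ i).factorial * (γ i + β i).descFactorial (β i) := fun i => by
      have := Nat.factorial_mul_descFactorial (Nat.le_add_left (β i) (γ i))
      rw [Nat.add_sub_cancel] at this
      exact_mod_cast this.symm
    simp only [Pi.add_apply, this, Finset.prod_mul_distrib]
    have h1 : ∏ i, ((γ i + β i).descFactorial (β i) : ℝ) ≠ 0 :=
      Finset.prod_ne_zero_iff.2 fun i _ => by simp
    field_simp

/-- No condition `b ≤ a` is needed: otherwise both sides vanish. -/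
lemma cast_descFactorial_eq_prod (a b : ℕ) :
    (a.descFactorial b : ℝ) = ∏ j ∈ Finset.range b, ((a : ℝ) - j) := by
  induction b with
  | zero => simp
  | succ b ih =>
    rw [Finset.prod_range_succ, ← ih, Nat.descFactorial_succ, Nat.cast_mul, mul_comm]
    rcases le_or_gt b a with h | h
    · rw [Nat.cast_sub h]
    · simp [Nat.descFactorial_of_lt h]

/-- The value of `P` at `t`, with each power `t i ^ b` replaced by the falling power
`t i * (t i - h) * ⋯ * (t i - (b - 1) * h)` of step `h`. -/
def fallingEval (P : MvPolynomial ι ℝ) (t : ι → ℝ) (h : ℝ) : ℝ :=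
  ∑ β ∈ P.support, P.coeff β * ∏ i, ∏ j ∈ Finset.range (β i), (t i - j * h)

lemma continuous_fallingEval (P : MvPolynomial ι ℝ) :
    Continuous fun x : (ι → ℝ) × ℝ => fallingEval P x.1 x.2 := by
  unfold fallingEval; fun_prop

lemma fallingEval_zero (P : MvPolynomial ι ℝ) (t : ι → ℝ) :
    fallingEval P t 0 = MvPolynomial.eval t P := by
  simp [fallingEval, MvPolynomial.eval_eq']

lemma sum_coeff_mul_descFactorial {P : MvPolynomial ι ℝ} {d : ℕ} (hP : P.IsHomogeneous d)
    {D : ℕ} (hD : D ≠ 0) (α : ι → ℕ) :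
    ∑ β ∈ P.support, P.coeff β * ∏ i, ((α i).descFactorial (β i) : ℝ)
      = D ^ d * fallingEval P (fun i => α i / D) (1 / D) := by
  rw [fallingEval, Finset.mul_sum]
  refine Finset.sum_congr rfl fun β hβ => ?_
  have hd : ∑ i, β i = d := by
    rw [← Finsupp.degree_eq_sum]
    exact not_imp_comm.1 hP.coeff_eq_zero (MvPolynomial.mem_support_iff.1 hβ)
  have hD' : (D : ℝ) ≠ 0 := by exact_mod_cast hD
  rw [← hd, ← Finset.prod_pow_eq_pow_sum, mul_left_comm, ← Finset.prod_mul_distrib]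
  congr 1
  refine Finset.prod_congr rfl fun i _ => ?_
  rw [cast_descFactorial_eq_prod, ← Finset.card_range (β i), ← Finset.prod_const,
    Finset.card_range, ← Finset.prod_mul_distrib]
  exact Finset.prod_congr rfl fun j _ => by field_simp

/-- Falling evaluation is continuous in the step `h` and is ordinary evaluation at `h = 0`, so
compactness of `{P ≥ δ}` in the simplex gives positivity there for all small steps. -/
theorem exists_nonneg_fallingEval (P : MvPolynomial ι ℝ) {δ : ℝ} (hδ : 0 < δ) (d : ℕ) :
    ∃ D : ℕ, d ≤ D ∧ D ≠ 0 ∧ ∀ t ∈ stdSimplex ℝ ι, δ ≤ MvPolynomial.eval t P →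
      0 ≤ fallingEval P t (1 / D) := by
  have hc : IsCompact {t ∈ stdSimplex ℝ ι | δ ≤ MvPolynomial.eval t P} :=
    (isCompact_stdSimplex ℝ ι).inter_right
      (isClosed_le continuous_const (MvPolynomial.continuous_eval P))
  have hev := hc.eventually_forall_of_forall_eventually (x₀ := (0 : ℝ))
    (P := fun h t => 0 < fallingEval P t h) fun t ht => by
      refine ((continuous_fallingEval P).comp continuous_swap).continuousAt.eventually_const_lt ?_
      simpa [fallingEval_zero] using hδ.trans_le ht.2
  obtain ⟨D, hD, hD1⟩ := ((tendsto_one_div_atTop_nhds_zero_nat.eventually hev).and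
    (Filter.eventually_ge_atTop (d + 1))).exists
  exact ⟨D, by omega, by omega, fun t ht hP => (hD t ⟨ht, hP⟩).le⟩

/-- A local form of Pólya's theorem: in high degree, the coefficient of `P(T)` at `α` is nonnegative
as soon as `P ≥ δ` at the point `α / D` of the simplex. -/
theorem exists_aeval_eq_sum_nonneg [DecidableEq ι] {A : Type*} [CommRing A] [Algebra ℝ A]
    {T : ι → A} (hT : ∑ i, T i = 1)
    {P : MvPolynomial ι ℝ} {d : ℕ} (hP : P.IsHomogeneous d) {δ : ℝ} (hδ : 0 < δ) :
    ∃ D : ℕ, D ≠ 0 ∧ ∃ c : (ι → ℕ) → ℝ,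
      (∀ α ∈ Finset.piAntidiag Finset.univ D,
        δ ≤ MvPolynomial.eval (fun i => (α i : ℝ) / D) P → 0 ≤ c α) ∧
      MvPolynomial.aeval T P =
        ∑ α ∈ Finset.piAntidiag Finset.univ D, c α • ∏ i, T i ^ α i := by
  obtain ⟨D, hdD, hD, h⟩ := exists_nonneg_fallingEval P hδ d
  refine ⟨D, hD, fun α => ((D - d).factorial : ℝ) / (∏ i, ((α i).factorial : ℝ)) *
    (D ^ d * fallingEval P (fun i => α i / D) (1 / D)), fun α hα hαP => ?_, ?_⟩
  · refine mul_nonneg (by positivity) (mul_nonneg (by positivity)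
      (h _ ⟨fun i => by positivity, ?_⟩ hαP))
    rw [← Finset.sum_div, ← Nat.cast_sum, (Finset.mem_piAntidiag.1 hα).1]
    exact div_self (by exact_mod_cast hD)
  · simp_rw [← sum_coeff_mul_descFactorial hP hD, Finset.mul_sum, Finset.sum_smul]
    rw [Finset.sum_comm, MvPolynomial.aeval_def, MvPolynomial.eval₂_eq']
    refine Finset.sum_congr rfl fun β hβ => ?_
    have hd : ∑ i, β i = d := by
      rw [← Finsupp.degree_eq_sum]
      exact not_imp_comm.1 hP.coeff_eq_zero (MvPolynomial.mem_support_iff.1 hβ)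
    rw [prod_pow_eq_sum_piAntidiag hT β (D - d), hd, Nat.sub_add_cancel hdD, Finset.mul_sum]
    refine Finset.sum_congr rfl fun α _ => ?_
    rw [← Algebra.smul_def, smul_smul]
    congr 1
    ring

end Polya

/-! ### Homogeneous polynomials on the standard simplex -/

section Homogeneous

variable {ι : Type*} [Fintype ι]

/-- Homogenization with respect to the linear form `∑ X i`, which is `1` on the simplex. -/
lemma exists_isHomogeneous_eval_eq (Q : MvPolynomial ι ℝ) {D : ℕ} (hD : Q.totalDegree ≤ D) :
    ∃ Q' : MvPolynomial ι ℝ, Q'.IsHomogeneous D ∧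
      ∀ t : ι → ℝ, ∑ i, t i = 1 → MvPolynomial.eval t Q' = MvPolynomial.eval t Q := by
  refine ⟨∑ k ∈ Finset.range (Q.totalDegree + 1),
    MvPolynomial.homogeneousComponent k Q * (∑ i, MvPolynomial.X i) ^ (D - k), ?_, ?_⟩
  · refine MvPolynomial.IsHomogeneous.sum _ _ _ fun k hk => ?_
    have hk' : k + 1 * (D - k) = D := by have := Finset.mem_range.1 hk; omega
    have := (MvPolynomial.homogeneousComponent_isHomogeneous k Q).mul
      ((MvPolynomial.IsHomogeneous.sum Finset.univ
        (fun i : ι => (MvPolynomial.X i : MvPolynomial ι ℝ)) 1 fun i _ => MvPolynomial.isHomogeneous_X ℝ i).pow (D - k))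
    rwa [hk'] at this
  · intro t ht
    conv_rhs => rw [← Q.sum_homogeneousComponent]
    simp [ht]

/-- A homogeneous polynomial vanishing on the face `u` of the standard simplex has no monomial in the
variables of `u` alone. -/
lemma coeff_eq_zero_of_eval_eq_zero {Q : MvPolynomial ι ℝ} {D : ℕ} (hQ : Q.IsHomogeneous D)
    (hD : D ≠ 0) (u : Finset ι)
    (h : ∀ t ∈ stdSimplex ℝ ι, (∀ i ∉ u, t i = 0) → MvPolynomial.eval t Q = 0)
    {α : ι →₀ ℕ} (hα : α.support ⊆ u) : MvPolynomial.coeff α Q = 0 := by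
  classical
  by_contra hne
  have hu : u.Nonempty := by
    rw [Finset.nonempty_iff_ne_empty]
    rintro rfl
    have h0 : α = 0 := Finsupp.support_eq_empty.1 (Finset.subset_empty.1 hα)
    refine hne (hQ.coeff_eq_zero ?_)
    simpa [h0] using hD.symm
  -- The part of `Q` in the variables of `u`; it is evaluated on the positive orthant by rescaling the
  -- coordinates in `u` to sum to `1`.
  let Q' : MvPolynomial ι ℝ := ∑ β ∈ Q.support with β.support ⊆ u,
    MvPolynomial.monomial β (Q.coeff β)
  have hQ' : Q' = 0 := by
    refine MvPolynomial.funext_set (fun _ => Set.Ioi (0 : ℝ)) (fun _ => Set.Ioi_infinite 0) ?_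
    intro y hy
    have hy : ∀ i, 0 < y i := fun i => hy i trivial
    set z : ι → ℝ := fun i => if i ∈ u then y i else 0
    set r : ℝ := ∑ i ∈ u, y i
    have hr : 0 < r := Finset.sum_pos (fun i _ => hy i) hu
    have e1 : MvPolynomial.eval y Q' = MvPolynomial.eval z Q := by
      rw [MvPolynomial.eval_eq' z Q]
      simp only [Q', map_sum, Finset.sum_filter]
      refine Finset.sum_congr rfl fun β _ => ?_
      split_ifs with hβ
      · rw [MvPolynomial.eval_monomial, Finsupp.prod_fintype _ _ (by simp)]
        congr 1
        refine Finset.prod_congr rfl fun i _ => ?_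
        by_cases hi : i ∈ u
        · simp [z, hi]
        · have : β i = 0 := Finsupp.notMem_support_iff.1 fun hi' => hi (hβ hi')
          simp [this]
      · obtain ⟨i, hi, hiu⟩ := Finset.not_subset.1 hβ
        rw [map_zero, Finset.prod_eq_zero (Finset.mem_univ i), mul_zero]
        simp [z, hiu, Finsupp.mem_support_iff.1 hi]
    have e2 : z = r • (fun i => z i / r) := by
      funext i
      simp [mul_div_cancel₀ _ hr.ne']
    have e3 : MvPolynomial.eval (fun i => z i / r) Q = 0 := by
      refine h _ ⟨fun i => ?_, ?_⟩ fun i hi => by simp [z, hi]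
      · have : 0 ≤ z i := by
          simp only [z]; split_ifs
          · exact (hy i).le
          · exact le_rfl
        positivity
      · rw [← Finset.sum_div, div_eq_one_iff_eq hr.ne']
        simp [z, r]
    rw [e1, e2, map_zero]
    rw [MvPolynomial.eval_eq'] at e3 ⊢
    rw [← mul_zero (r ^ D), ← e3, Finset.mul_sum]
    refine Finset.sum_congr rfl fun β hβ => ?_
    have hd : ∑ i, β i = D := by
      rw [← Finsupp.degree_eq_sum]
      exact not_imp_comm.1 hQ.coeff_eq_zero (MvPolynomial.mem_support_iff.1 hβ)
    simp only [Pi.smul_apply, smul_eq_mul, mul_pow, Finset.prod_mul_distrib,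
      Finset.prod_pow_eq_pow_sum, hd]
    ring
  have hc : Q'.coeff α = Q.coeff α := by
    simp only [Q', MvPolynomial.coeff_sum, MvPolynomial.coeff_monomial]
    rw [Finset.sum_ite_eq', if_pos]
    simpa [hα] using hne
  exact hne (by rw [← hc, hQ', MvPolynomial.coeff_zero])

end Homogeneous

/-! ### Barycentric coordinates on a simplicial complex -/

section Complex

variable {n : ℕ} {K : Geometry.SimplicialComplex ℝ (EuclideanSpace ℝ (Fin n))}
  {ι : Type*}

/-- Evaluation at a point of the complex, as an algebra homomorphism. -/
def C0.evalAt (x : K.space) : C0 K →ₐ[ℝ] ℝ :=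
  (ContinuousMap.evalAlgHom ℝ ℝ x).comp (C0 K).val

lemma C0.evalAt_apply (x : K.space) (f : C0 K) : C0.evalAt x f = (f : C(K.space, ℝ)) x := rfl

lemma C0.ext_evalAt {f g : C0 K} (h : ∀ x, C0.evalAt x f = C0.evalAt x g) : f = g :=
  Subtype.ext (ContinuousMap.ext h)

lemma C0.evalAt_aeval (x : K.space) (T : ι → C0 K) (P : MvPolynomial ι ℝ) :
    C0.evalAt x (MvPolynomial.aeval T P) =
      MvPolynomial.eval (fun i => (T i : C(K.space, ℝ)) x) P := by
  exact MvPolynomial.comp_aeval_apply _ (C0.evalAt x) P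

variable (v : ι ≃ K.vertices)

/-- The vertices with index in `u`, for an enumeration `v` of the vertices of `K`. -/
abbrev geomFace (u : Finset ι) : Finset (EuclideanSpace ℝ (Fin n)) :=
  u.map (v.toEmbedding.trans (Function.Embedding.subtype _))

/-- The index set `u` enumerates the vertices of a face, that is, `u` belongs to the abstract
simplicial complex of `K`. -/
def IsIndexFace (u : Finset ι) : Prop :=
  geomFace v u ∈ K.faces

variable {v} in
lemma IsIndexFace.mono {u w : Finset ι} (hu : IsIndexFace v u) (hwu : w ⊆ u) (hw : w.Nonempty) :
    IsIndexFace v w :=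
  K.down_closed hu (Finset.map_subset_map.2 hwu) (hw.map)

variable [Fintype ι]

lemma mem_hull_index {u : Finset ι} (x : EuclideanSpace ℝ (Fin n)) :
    x ∈ convexHull ℝ (geomFace v u : Set (EuclideanSpace ℝ (Fin n)))
    ↔ ∃ t ∈ stdSimplex ℝ ι, (∀ i ∉ u, t i = 0) ∧
        ∑ i, t i • (v i : EuclideanSpace ℝ (Fin n)) = x := by
  classical
  rw [Finset.mem_convexHull']
  simp only [geomFace, Finset.mem_map, forall_exists_index, and_imp, forall_apply_eq_imp_iff₂,
    Finset.sum_map]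
  constructor
  · rintro ⟨w, hw0, hw1, hwx⟩
    refine ⟨fun i => if i ∈ u then w (v i) else 0, ⟨fun i => ?_, ?_⟩, fun i hi => by simp [hi], ?_⟩
    · dsimp only
      split_ifs with hi
      · exact hw0 i hi
      · exact le_rfl
    · simpa using hw1
    · simpa [ite_smul] using hwx
  · rintro ⟨t, ⟨ht0, ht1⟩, htu, rfl⟩
    let w : EuclideanSpace ℝ (Fin n) → ℝ := fun y =>
      if hy : y ∈ K.vertices then t (v.symm ⟨y, hy⟩) else 0
    have hw : ∀ i, w (v i) = t i := fun i => by simp [w]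
    refine ⟨w, fun i _ => (hw i).symm ▸ ht0 i, ?_, ?_⟩
    · rw [← ht1]
      simp only [Function.Embedding.trans_apply, Equiv.coe_toEmbedding,
        Function.Embedding.subtype_apply, hw]
      exact Finset.sum_subset (Finset.subset_univ _) fun i _ hi => htu i hi
    · simp only [Function.Embedding.trans_apply, Equiv.coe_toEmbedding,
        Function.Embedding.subtype_apply, hw]
      exact Finset.sum_subset (Finset.subset_univ _) fun i _ hi => by rw [htu i hi, zero_smul]

lemma exists_index_face {s : Finset (EuclideanSpace ℝ (Fin n))} (hs : s ∈ K.faces) :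
    ∃ u : Finset ι, geomFace v u = s := by
  classical
  refine ⟨Finset.univ.filter fun i => (v i : EuclideanSpace ℝ (Fin n)) ∈ s, ?_⟩
  ext y
  simp only [geomFace, Finset.mem_map, Finset.mem_filter, Finset.mem_univ, true_and]
  refine ⟨?_, fun hy => ?_⟩
  · rintro ⟨i, hi, rfl⟩
    exact hi
  · have hyv : y ∈ K.vertices :=
      K.down_closed hs (Finset.singleton_subset_iff.2 hy) (Finset.singleton_nonempty _)
    exact ⟨v.symm ⟨y, hyv⟩, by simpa using hy, by simp⟩

end Complex

/-! ### Tent functions generate the spline algebra -/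

section Tent

variable {n : ℕ} {K : Geometry.SimplicialComplex ℝ (EuclideanSpace ℝ (Fin n))}
  {ι : Type*} [Fintype ι] {v : ι ≃ K.vertices} {T : ι → C0 K}

/-- On each face the tent functions are the barycentric coordinates. -/
lemma tent_apply (hT : ∀ i, IsTentFunction K (v i) (T i)) {u : Finset ι} (hu : IsIndexFace v u)
    {t : ι → ℝ} (ht : t ∈ stdSimplex ℝ ι) (htu : ∀ i ∉ u, t i = 0) (x : K.space)
    (hx : ∑ i, t i • (v i : EuclideanSpace ℝ (Fin n)) = x) (i : ι) :
    (T i : C(K.space, ℝ)) x = t i := by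
  classical
  obtain ⟨g, hg⟩ := (hT i).piecewise_linear _ hu
  have hgv : ∀ j ∈ u, g (v j) = if j = i then 1 else 0 := by
    intro j hj
    have hjx := hg ⟨v j, K.vertices_subset_space (v j).2⟩ (subset_convexHull ℝ _
      (Finset.mem_coe.2 (Finset.mem_map_of_mem _ hj)))
    rw [← hjx]
    split_ifs with h
    · rw [h]; exact (hT i).apply_self
    · exact (hT i).apply_of_ne _ fun e => h (v.injective e)
  have hsum : g (∑ j, t j • (v j : EuclideanSpace ℝ (Fin n))) = ∑ j, t j * g (v j) := by
    have h1 : ∀ y, g y = g.linear y + g 0 := fun y => congrFun g.decomp y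
    simp only [h1 (∑ j, t j • (v j : EuclideanSpace ℝ (Fin n))), h1 (v _), mul_add,
      Finset.sum_add_distrib, ← Finset.sum_mul, ht.2, one_mul, map_sum, map_smul, smul_eq_mul]
  rw [hg x ((mem_hull_index v _).2 ⟨t, ht, htu, hx⟩), ← hx, hsum]
  have : ∀ j, t j * g (v j) = if j = i then t j else 0 := by
    intro j
    by_cases hj : j ∈ u
    · rw [hgv j hj]; simp
    · simp [htu j hj]
  simp [this]

lemma exists_mem_space (hT : ∀ i, IsTentFunction K (v i) (T i)) {u : Finset ι}
    (hu : IsIndexFace v u) {t : ι → ℝ} (ht : t ∈ stdSimplex ℝ ι) (htu : ∀ i ∉ u, t i = 0) :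
    ∃ x : K.space, (x : EuclideanSpace ℝ (Fin n)) ∈
      convexHull ℝ (geomFace v u : Set (EuclideanSpace ℝ (Fin n))) ∧
        ∀ i, (T i : C(K.space, ℝ)) x = t i := by
  have hx := (mem_hull_index v (u := u) _).2 ⟨t, ht, htu, rfl⟩
  exact ⟨⟨_, Geometry.SimplicialComplex.convexHull_subset_space hu hx⟩, hx,
    tent_apply hT hu ht htu _ rfl⟩

lemma tent_mem_stdSimplex (hT : ∀ i, IsTentFunction K (v i) (T i)) {u : Finset ι}
    (hu : IsIndexFace v u) {x : K.space} (hx : (x : EuclideanSpace ℝ (Fin n)) ∈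
      convexHull ℝ (geomFace v u : Set (EuclideanSpace ℝ (Fin n)))) :
    (fun i => (T i : C(K.space, ℝ)) x) ∈ stdSimplex ℝ ι ∧
      (∀ i ∉ u, (T i : C(K.space, ℝ)) x = 0) ∧
      ∑ i, (T i : C(K.space, ℝ)) x • (v i : EuclideanSpace ℝ (Fin n)) = x := by
  obtain ⟨t, ht, htu, htx⟩ := (mem_hull_index v _).1 hx
  have : (fun i => (T i : C(K.space, ℝ)) x) = t := funext (tent_apply hT hu ht htu x htx)
  simp only [tent_apply hT hu ht htu x htx]
  exact ⟨ht, htu, htx⟩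

variable (v) in
lemma exists_isIndexFace (x : K.space) : ∃ u : Finset ι, IsIndexFace v u ∧
    (x : EuclideanSpace ℝ (Fin n)) ∈
      convexHull ℝ (geomFace v u : Set (EuclideanSpace ℝ (Fin n))) := by
  obtain ⟨s, hs, hx⟩ := Geometry.SimplicialComplex.mem_space_iff.1 x.2
  obtain ⟨u, rfl⟩ := exists_index_face v hs
  exact ⟨u, hs, hx⟩

lemma sum_tent (hT : ∀ i, IsTentFunction K (v i) (T i)) : ∑ i, T i = 1 := by
  refine C0.ext_evalAt fun x => ?_
  obtain ⟨u, hu, hx⟩ := exists_isIndexFace v x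
  rw [map_sum, map_one]
  exact (tent_mem_stdSimplex hT hu hx).1.2

/-- The Stanley–Reisner relations: a product of tent functions vanishes unless the vertices involved
span a face. -/
lemma prod_tent_pow_eq_zero (hT : ∀ i, IsTentFunction K (v i) (T i)) {α : ι → ℕ} (hα0 : α ≠ 0)
    (hα : ¬ IsIndexFace v {i | α i ≠ 0}) : ∏ i, T i ^ α i = 0 := by
  refine C0.ext_evalAt fun x => ?_
  obtain ⟨u, hu, hx⟩ := exists_isIndexFace v x
  have hsub : ¬ (Finset.univ.filter fun i => α i ≠ 0) ⊆ u := by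
    intro hsub
    refine hα (hu.mono hsub ?_)
    obtain ⟨i, hi⟩ := Function.ne_iff.1 hα0
    exact ⟨i, by simpa using hi⟩
  obtain ⟨i, hi, hiu⟩ := Finset.not_subset.1 hsub
  rw [map_prod, map_zero]
  refine Finset.prod_eq_zero (Finset.mem_univ i) ?_
  rw [map_pow, C0.evalAt_apply, (tent_mem_stdSimplex hT hu hx).2.1 i hiu]
  exact zero_pow (by simpa using hi)

lemma exists_eval_tent_eq_of_face (hT : ∀ i, IsTentFunction K (v i) (T i)) (F : C0 K)
    {u : Finset ι} (hu : IsIndexFace v u) :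
    ∃ Q : MvPolynomial ι ℝ, ∀ x : K.space, (x : EuclideanSpace ℝ (Fin n)) ∈
      convexHull ℝ (geomFace v u : Set (EuclideanSpace ℝ (Fin n))) →
      MvPolynomial.eval (fun i => (T i : C(K.space, ℝ)) x) Q = (F : C(K.space, ℝ)) x := by
  obtain ⟨p, hp⟩ := F.2 _ hu
  refine ⟨MvPolynomial.bind₁ (fun k : Fin n => ∑ i, MvPolynomial.C
    ((v i : EuclideanSpace ℝ (Fin n)) k) * MvPolynomial.X i) p, fun x hx => ?_⟩
  rw [hp x hx]
  have hc : (fun k => (x : EuclideanSpace ℝ (Fin n)) k) = fun k => MvPolynomial.eval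
      (fun i => (T i : C(K.space, ℝ)) x) (∑ i, MvPolynomial.C
        ((v i : EuclideanSpace ℝ (Fin n)) k) * MvPolynomial.X i) := by
    funext k
    conv_lhs => rw [← (tent_mem_stdSimplex hT hu hx).2.2]
    simp [mul_comm]
  rw [hc]
  exact MvPolynomial.eval₂Hom_bind₁ (RingHom.id ℝ) _ _ _

/-- The tent functions generate `C0 K`. On each face, a spline is a unique homogeneous polynomial of
a common degree in the barycentric coordinates; by uniqueness the coefficient of a monomial does not
depend on the face chosen, so these polynomials glue. -/
theorem exists_isHomogeneous_aeval_tent_eq (hT : ∀ i, IsTentFunction K (v i) (T i)) (F : C0 K) :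
    ∃ (P : MvPolynomial ι ℝ) (d : ℕ), P.IsHomogeneous d ∧ MvPolynomial.aeval T P = F := by
  classical
  choose! Q₀ hQ₀ using fun (u : Finset ι) (hu : IsIndexFace v u) =>
    exists_eval_tent_eq_of_face hT F hu
  obtain ⟨D, hD, hDQ⟩ : ∃ D, D ≠ 0 ∧ ∀ u, (Q₀ u).totalDegree ≤ D :=
    ⟨(Finset.univ.sup fun u => (Q₀ u).totalDegree) + 1, by simp, fun u =>
      (Finset.le_sup (f := fun u => (Q₀ u).totalDegree) (Finset.mem_univ u)).trans (Nat.le_succ _)⟩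
  choose Q hQh hQ using fun u => exists_isHomogeneous_eval_eq (Q₀ u) (hDQ u)
  have hQF : ∀ u, IsIndexFace v u → ∀ x : K.space, (x : EuclideanSpace ℝ (Fin n)) ∈
      convexHull ℝ (geomFace v u : Set (EuclideanSpace ℝ (Fin n))) →
      MvPolynomial.eval (fun i => (T i : C(K.space, ℝ)) x) (Q u) = (F : C(K.space, ℝ)) x :=
    fun u hu x hx => (hQ u _ (tent_mem_stdSimplex hT hu hx).1.2).trans (hQ₀ u hu x hx)
  -- The coefficient at `α` may be read off on the smallest face that involves `α`.
  have hcompat : ∀ u, IsIndexFace v u → ∀ α : ι →₀ ℕ, α.degree = D → α.support ⊆ u →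
      (Q α.support).coeff α = (Q u).coeff α := by
    intro u hu α hα hαu
    have hne : α.support.Nonempty := by
      rw [Finset.nonempty_iff_ne_empty, Ne, Finsupp.support_eq_empty]
      rintro rfl
      simp at hα
      exact hD hα.symm
    have hw := hu.mono hαu hne
    rw [← sub_eq_zero, ← MvPolynomial.coeff_sub]
    refine coeff_eq_zero_of_eval_eq_zero ((hQh _).sub (hQh u)) hD α.support (fun t ht htu => ?_)
      subset_rfl
    obtain ⟨x, hx, hxt⟩ := exists_mem_space hT hw ht htu
    have hxu := convexHull_mono (𝕜 := ℝ)
      (Finset.coe_subset.2 (Finset.map_subset_map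
        (f := v.toEmbedding.trans (.subtype _)).2 hαu)) hx
    rw [← funext hxt, map_sub, hQF _ hw x hx, hQF u hu x hxu, sub_self]
  refine ⟨∑ α ∈ Finset.finsuppAntidiag Finset.univ D,
    MvPolynomial.monomial α ((Q α.support).coeff α), D, ?_, ?_⟩
  · refine MvPolynomial.IsHomogeneous.sum _ _ _ fun α hα => MvPolynomial.isHomogeneous_monomial _ ?_
    rw [Finsupp.degree_eq_sum]
    exact (Finset.mem_finsuppAntidiag.1 hα).1
  · refine C0.ext_evalAt fun x => ?_
    obtain ⟨u, hu, hx⟩ := exists_isIndexFace v x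
    rw [C0.evalAt_aeval, C0.evalAt_apply, ← hQF u hu x hx, MvPolynomial.eval_eq' _ (Q u), map_sum]
    have hsub : (Q u).support ⊆ Finset.finsuppAntidiag Finset.univ D := by
      intro α hα
      have := not_imp_comm.1 (hQh u).coeff_eq_zero (MvPolynomial.mem_support_iff.1 hα)
      rw [Finsupp.degree_eq_sum] at this
      simpa using this
    rw [Finset.sum_subset hsub fun α _ hα => by
      rw [MvPolynomial.notMem_support_iff.1 hα, zero_mul]]
    refine Finset.sum_congr rfl fun α hα => ?_
    rw [MvPolynomial.eval_monomial, Finsupp.prod_fintype _ _ (by simp)]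
    by_cases hαu : α.support ⊆ u
    · rw [hcompat u hu α _ hαu]
      rw [Finsupp.degree_eq_sum]
      exact (Finset.mem_finsuppAntidiag.1 hα).1
    · obtain ⟨i, hi, hiu⟩ := Finset.not_subset.1 hαu
      rw [Finset.prod_eq_zero (Finset.mem_univ i), mul_zero, mul_zero]
      rw [(tent_mem_stdSimplex hT hu hx).2.1 i hiu]
      exact zero_pow (Finsupp.mem_support_iff.1 hi)

end Tent

/-! ### Positive splines -/

section Main

variable {n : ℕ} {K : Geometry.SimplicialComplex ℝ (EuclideanSpace ℝ (Fin n))}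

lemma exists_pos_le (hK : K.faces.Finite) (F : C0 K)
    (hF : ∀ x : K.space, 0 < (F : C(K.space, ℝ)) x) :
    ∃ δ : ℝ, 0 < δ ∧ ∀ x : K.space, δ ≤ (F : C(K.space, ℝ)) x := by
  have hc : IsCompact K.space :=
    hK.isCompact_biUnion fun s _ => s.finite_toSet.isCompact_convexHull ℝ
  have : CompactSpace K.space := isCompact_iff_compactSpace.1 hc
  rcases isEmpty_or_nonempty K.space with h | h
  · exact ⟨1, one_pos, fun x => h.elim x⟩
  · obtain ⟨x, -, hx⟩ := isCompact_univ.exists_isMinOn Set.univ_nonempty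
      (F : C(K.space, ℝ)).continuous.continuousOn
    exact ⟨_, hF x, fun y => hx (Set.mem_univ y)⟩

variable {ι : Type*} [Fintype ι] {v : ι ≃ K.vertices} {T : ι → C0 K}

/-- By Pólya's theorem `F` is a combination of monomials in the tent functions; those whose support
is a face have nonnegative coefficients, and all others are zero in `C0 K`. -/
lemma mem_seqClosure_of_pos (hK : K.faces.Finite) (hT : ∀ i, IsTentFunction K (v i) (T i))
    {M : Submodule (Subsemiring.sumSq (C0 K)) (C0 K)} (h1 : 1 ∈ M) (hTM : ∀ i, T i ∈ M)
    (F : C0 K) (hF : ∀ x : K.space, 0 < (F : C(K.space, ℝ)) x) : F ∈ seqClosure M := by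
  classical
  obtain ⟨δ, hδ, hδF⟩ := exists_pos_le hK F hF
  obtain ⟨P, d, hP, hPF⟩ := exists_isHomogeneous_aeval_tent_eq hT F
  obtain ⟨D, hD, c, hc, hcP⟩ := exists_aeval_eq_sum_nonneg (sum_tent hT) hP hδ
  have hT' : ∀ i, 1 - T i ∈ M := fun i => by
    rw [← sum_tent hT, ← Finset.sum_erase_eq_sub (Finset.mem_univ i)]
    exact M.sum_mem fun j _ => hTM j
  rw [← hPF, hcP]
  refine sum_mem_seqClosure h1 _ fun α hα => ?_
  have hαD := (Finset.mem_piAntidiag.1 hα).1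
  have hα0 : α ≠ 0 := by
    rintro rfl
    simp at hαD
    exact hD hαD.symm
  by_cases hu : IsIndexFace v {i | α i ≠ 0}
  · refine smul_mem_seqClosure h1 (hc α hα ?_) (prod_pow_mem_seqClosure h1 hTM hT' _ α).1
    obtain ⟨x, -, hx⟩ := exists_mem_space hT hu (t := fun i => (α i : ℝ) / D)
      ⟨fun i => by positivity, by
        rw [← Finset.sum_div, ← Nat.cast_sum, hαD, div_self (by exact_mod_cast hD)]⟩
      (fun i hi => by simp at hi; simp [hi])
    rw [← funext hx, ← C0.evalAt_aeval, hPF]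
    exact hδF x
  · rw [prod_tent_pow_eq_zero hT hα0 hu, smul_zero]
    exact zero_mem_seqClosure h1

theorem mem_of_pos (hK : K.faces.Finite) (hT : ∀ i, IsTentFunction K (v i) (T i))
    {M : Submodule (Subsemiring.sumSq (C0 K)) (C0 K)} (h1 : 1 ∈ M) (hTM : ∀ i, T i ∈ M)
    (F : C0 K) (hF : ∀ x : K.space, 0 < (F : C(K.space, ℝ)) x) : F ∈ M := by
  obtain ⟨δ, hδ, hδF⟩ := exists_pos_le hK F hF
  have h := mem_seqClosure_of_pos hK hT h1 hTM (F - algebraMap ℝ _ (δ / 2)) (fun x => by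
    have hx : ((F - algebraMap ℝ (C0 K) (δ / 2) : C0 K) : C(K.space, ℝ)) x
        = (F : C(K.space, ℝ)) x - δ / 2 := rfl
    rw [hx]
    linarith [hδF x]) (δ / 2) (by positivity)
  simpa using h

end Main

end SimplicialSpline

end

theorem mainTheorem2 {n m : ℕ} (K : Geometry.SimplicialComplex ℝ (EuclideanSpace ℝ (Fin n)))
    (hK : K.faces.Finite) (v : Fin m ≃ K.vertices) (F : SimplicialSpline.C0 K)
    (hF : ∀ x : K.space, 0 < (F : C(K.space, ℝ)) x) :
    ∃ (S₀ : SimplicialSpline.C0 K) (S : Fin m → SimplicialSpline.C0 K),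
      IsSumSq S₀ ∧ (∀ i, IsSumSq (S i)) ∧
        F = S₀ + ∑ i, S i * SimplicialSpline.tentFunction K hK (v i) := by
  have h := SimplicialSpline.mem_of_pos hK
    (fun i => SimplicialSpline.isTentFunction_tentFunction K hK (v i))
    (M := Submodule.span _
      (insert 1 (Set.range fun i => SimplicialSpline.tentFunction K hK (v i))))
    (Submodule.subset_span (Set.mem_insert _ _))
    (fun i => Submodule.subset_span (Set.mem_insert_of_mem _ ⟨i, rfl⟩)) F hF
  obtain ⟨a, z, hz, rfl⟩ := Submodule.mem_span_insert.1 h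
  obtain ⟨c, rfl⟩ := (Submodule.mem_span_range_iff_exists_fun _).1 hz
  refine ⟨a, fun i => c i, Subsemiring.mem_sumSq.1 a.2, fun i => Subsemiring.mem_sumSq.1 (c i).2, ?_⟩
  simp only [Subsemiring.smul_def, smul_eq_mul, mul_one]
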